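/- Let $\mathbb{Z}^{13,1}$ be the lattice with basis $e_0,e_1,\dots,e_{13}$ and bilinear form $(e_0,e_0)=-1$, $(e_0,e_i)=0$, $(e_i,e_j)=\delta_{ij}$ for $1\le i,j\le 13$. Let $\mathbb{R}^{13,1}=\mathbb{R}\otimes\mathbb{Z}^{13,1}$, let $\mathbb{R}^{13,1}_+=\{x=\sum_i x_ie_i : (x,x)<0,\ x_0>0\}$, and let $\mathbb{B}^{13}=\mathbb{R}^{13,1}_+/\mathbb{R}_{+}$ be real hyperbolic space, where $\mathbb{R}_{+}$ denotes the positive reals acting by scaling. Let $G$ be the closed fundamental chamber (in the closure of $\mathbb{R}^{13,1}_+$) of the group generated by the reflections $x\mapsto x-2(x,\alpha)\alpha$ in the vectors $\alpha\in\mathbb{Z}^{13,1}$ with $(\alpha,\alpha)=1$ that contains the points $e_0-(\epsilon_1e_1+\cdots+\epsilon_{13}e_{13})$ for all sufficiently small $\epsilon_1>\cdots>\epsilon_{13}>0$; that is, $G$ is the closure in $\mathbb{R}^{13,1}$ of the connected component containing these points of the set of $x\in\mathbb{R}^{13,1}_+$ with $(x,\alpha)\neq0$ for all such $\alpha$. Let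 $\mathcal{P}$ and $\mathcal{L}$ be the sets of the $13$ points and the $13$ lines of the projective plane $\mathbb{P}^2(3)$ over the field of $3$ elements. Fix any bijection $\mathcal{P}\to\{1,\dots,13\}$, so that $e_p\in\mathbb{Z}^{13,1}$ is defined for $p\in\mathcal{P}$, and put $e_l=e_0-\sum_{p\in l}e_p$ for $l\in\mathcal{L}$. Then $(e_p,e_q)=\delta_{pq}$ for $p,q\in\mathcal{P}$, $(e_l,e_m)=3\delta_{lm}$ for $l,m\in\mathcal{L}$, and $(e_p,e_l)=-1$ if $p\in l$ and $(e_p,e_l)=0$ if $p\notin l$. Moreover, if $$P=\{x\in\mathbb{R}^{13,1} : (x,e_p)\le 0 \text{ and } (x,e_l)\le 0 \text{ for all } p\in\mathcal{P},\ l\in\mathcal{L}\},$$ then the hyperbolic polytope induced by $P$ in $\mathbb{B}^{13}$, that is, the image of $P\cap\mathbb{R}^{13,1}_+$, has finite hyperbolic volume, and $P\subset G$. -/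

import Mathlib

open MeasureTheory
open scoped LinearAlgebra.Projectivization

/-! ## Lorentzian space -/

/-- The real vector space underlying `ℝ^{n,1}`, with coordinates `x₀, x₁, …, xₙ`
relative to the basis `e₀, e₁, …, eₙ`. -/
abbrev LorentzSpace (n : ℕ) : Type := Fin (n + 1) → ℝ

/-- The Lorentzian inner product `(x, y) = - x₀ y₀ + x₁ y₁ + ⋯ + xₙ yₙ`. -/
def lorentzInner {n : ℕ} (x y : LorentzSpace n) : ℝ :=
  -(x 0 * y 0) + ∑ i : Fin n, x i.succ * y i.succ

/-- The basis vector `eᵢ`, for `i = 0, 1, …, n`. -/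
def lorentzBasis {n : ℕ} (i : Fin (n + 1)) : LorentzSpace n := Pi.single i 1

/-- The odd unimodular Lorentzian lattice `ℤ^{n,1}`: the integral combinations of
`e₀, …, eₙ`. -/
def lorentzLattice (n : ℕ) : Set (LorentzSpace n) :=
  {x | ∀ i, ∃ m : ℤ, x i = (m : ℝ)}

/-- The forward light cone `ℝ^{n,1}_+`. -/
def forwardCone (n : ℕ) : Set (LorentzSpace n) :=
  {x | lorentzInner x x < 0 ∧ 0 < x 0}

/-! ## Hyperbolic space -/

/-- The projection `ℝ^{n,1}_+ → 𝔹ⁿ = ℝ^{n,1}_+ / ℝ_+`. Its fibres on the forward cone are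
exactly the open rays and its image is the open unit ball (the projective or Klein model);
the class of `x` is represented by the point `(x₁/x₀, …, xₙ/x₀)`. -/
noncomputable def toHyperbolicBall {n : ℕ} (x : LorentzSpace n) : EuclideanSpace ℝ (Fin n) :=
  WithLp.toLp 2 fun i => x i.succ / x 0

/-- The hyperbolic volume on `𝔹ⁿ` in the projective model: the Riemannian volume
`(1 - |y|²)^{-(n+1)/2} dy` of the metric of curvature `-1`
`|dy|² / (1 - |y|²) + (y · dy)² / (1 - |y|²)²` on the open unit ball. -/
noncomputable def hyperbolicVolume (n : ℕ) : Measure (EuclideanSpace ℝ (Fin n)) :=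
  ((volume : Measure (EuclideanSpace ℝ (Fin n))).restrict (Metric.ball 0 1)).withDensity
    fun y => ENNReal.ofReal ((1 - ‖y‖ ^ 2) ^ (-((n : ℝ) + 1) / 2))

/-- The subset of hyperbolic space `𝔹ⁿ` induced by a cone `C` in `ℝ^{n,1}`. -/
def inducedHyperbolicSet {n : ℕ} (C : Set (LorentzSpace n)) : Set (EuclideanSpace ℝ (Fin n)) :=
  toHyperbolicBall '' (C ∩ forwardCone n)

/-! ## The chamber for the norm one roots -/

/-- The norm one roots: the vectors `α` in `ℤ^{n,1}` with `(α, α) = 1`. -/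
def normOneRoots (n : ℕ) : Set (LorentzSpace n) :=
  {α | α ∈ lorentzLattice n ∧ lorentzInner α α = 1}

/-- The complement in the forward light cone of the mirrors of the reflections
`x ↦ x - 2 (x, α) α` in the norm one roots `α`. Its connected components are the open
chambers of the reflection group generated by these reflections. -/
def mirrorComplement (n : ℕ) : Set (LorentzSpace n) :=
  {x | x ∈ forwardCone n ∧ ∀ α ∈ normOneRoots n, lorentzInner x α ≠ 0}

/-- The open chamber of the group generated by the norm one reflections: the connected component
of the complement of the mirrors that contains the points `e₀ - (ε₁ e₁ + ⋯ + εₙ eₙ)` for all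
sufficiently small `ε₁ > ⋯ > εₙ > 0`. -/
def openNormOneChamber (n : ℕ) : Set (LorentzSpace n) :=
  {x | ∃ δ : ℝ, 0 < δ ∧ ∀ ε : Fin n → ℝ, StrictAnti ε → (∀ i, 0 < ε i ∧ ε i < δ) →
    lorentzBasis 0 - ∑ i : Fin n, ε i • lorentzBasis i.succ
      ∈ connectedComponentIn (mirrorComplement n) x}

/-- The closed fundamental chamber `G` (in the closure of `ℝ^{n,1}_+`) of the Coxeter group
generated by the reflections in the norm one roots. -/
def normOneChamber (n : ℕ) : Set (LorentzSpace n) :=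
  closure (openNormOneChamber n)

/-! ## The projective plane of order three -/

/-- The points of the projective plane `ℙ²(3)` over the field with three elements. -/
abbrev PlanePoint : Type := ℙ (ZMod 3) (Fin 3 → ZMod 3)

/-- The lines of `ℙ²(3)`, given by the nonzero linear equations up to scalars. The relation
`p ∈ l` is the incidence relation of Mathlib's `Configuration.ofField`: the point `p` satisfies
the equation of `l`, that is, the dot product of representatives vanishes. -/
abbrev PlaneLine : Type := ℙ (ZMod 3) (Fin 3 → ZMod 3)

/-- The vector `e_p`, for a point `p` and a numbering `σ` of the points. -/
def pointRoot (σ : PlanePoint ≃ Fin 13) (p : PlanePoint) : LorentzSpace 13 :=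
  lorentzBasis (σ p).succ

open Classical in
/-- The vector `e_l = e₀ - ∑_{p ∈ l} e_p`, for a line `l`. -/
noncomputable def lineRoot (σ : PlanePoint ≃ Fin 13) (l : PlaneLine) : LorentzSpace 13 :=
  lorentzBasis 0 - ∑ i : Fin 13, if σ.symm i ∈ l then pointRoot σ (σ.symm i) else 0

/-- The convex cone `P`, cut out by `(x, e_p) ≤ 0` and `(x, e_l) ≤ 0`. -/
def incidenceCone (σ : PlanePoint ≃ Fin 13) : Set (LorentzSpace 13) :=
  {x | (∀ p : PlanePoint, lorentzInner x (pointRoot σ p) ≤ 0) ∧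
    ∀ l : PlaneLine, lorentzInner x (lineRoot σ l) ≤ 0}

/-! ## The cyclic model of the projective plane of order three -/

/-! After scaling to `x 0 = 1` and putting `z i = -x i`, the cone becomes `weightPolytope`:
nonnegative weights on the points with sum at most one along every line. Everything geometric
follows from two inequalities for such weights. The inner products of the roots are incidence
counts.

The first, `sum_sq_le_one`, puts the polytope in the closed unit ball. Hence it is the convex hull
of finitely many vertices, some perhaps ideal. By a variance argument `1 - ‖y‖²` is bounded below by
a multiple of the distance from `y` to some vertex, so the hyperbolic density is dominated by a sum
of functions `‖y - v‖ ^ (-(n+1)/2)`. These are integrable because `(n+1)/2 < n`.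

The second, `sum_int_mul_le`, says that an integral vector `b ≥ 0` with `∑ b i ² ≤ a² + 1`, `a ≥ 1`,
satisfies `∑ b i * z i ≤ a`. Cauchy-Schwarz alone would give `√(a² + 1)`; integrality closes the
gap, by induction on `a`, subtracting lines or thirds of lines. Applied to the negative parts of the
coordinates of a norm one root, it shows that no mirror meets the open cone. That cone is convex and
contains the base points of the chamber, so it lies in the chamber, and taking closures finishes. -/

/-- The line with index `l` in the cyclic model, a translate of the perfect difference set
`{0, 1, 3, 9}` in `ZMod 13`. -/
def singerLine (l : ZMod 13) : Finset (ZMod 13) := {l, l + 1, l + 3, l + 9}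

theorem card_singerLine_inter (l m : ZMod 13) :
    (singerLine l ∩ singerLine m).card = if l = m then 4 else 1 := by
  revert l m; decide

theorem sum_singerLine {M : Type*} [AddCommMonoid M] (g : ZMod 13 → M) (l : ZMod 13) :
    ∑ i ∈ singerLine l, g i = g l + (g (l + 1) + (g (l + 3) + g (l + 9))) := by
  have h1 : l ∉ ({l + 1, l + 3, l + 9} : Finset (ZMod 13)) := by revert l; decide
  have h2 : l + 1 ∉ ({l + 3, l + 9} : Finset (ZMod 13)) := by revert l; decide
  have h3 : l + 3 ∉ ({l + 9} : Finset (ZMod 13)) := by revert l; decide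
  rw [singerLine, Finset.sum_insert h1, Finset.sum_insert h2, Finset.sum_insert h3,
    Finset.sum_singleton]

theorem sum_zmod_thirteen {M : Type*} [AddCommMonoid M] (g : ZMod 13 → M) :
    ∑ i, g i = g 0 + (g 1 + (g 2 + (g 3 + (g 4 + (g 5 + (g 6 + (g 7 + (g 8 + (g 9 + (g 10 +
      (g 11 + g 12))))))))))) := by
  have h : ∀ f : Fin 13 → M, ∑ i, f i = f 0 + (f 1 + (f 2 + (f 3 + (f 4 + (f 5 + (f 6 + (f 7 +
      (f 8 + (f 9 + (f 10 + (f 11 + f 12))))))))))) := by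
    intro f
    simp only [Fin.sum_univ_succ, Fin.sum_univ_zero, add_zero]
    rfl
  exact h g

/-- The convex polytope of nonnegative weights on the points whose sum along each line is at most
one. -/
def weightPolytope : Set (ZMod 13 → ℝ) :=
  {z | (∀ i, 0 ≤ z i) ∧ ∀ l, ∑ i ∈ singerLine l, z i ≤ 1}

/-! ### The sum of squares of a weight -/

theorem exists_max_of_three (a b c : ℝ) :
    ∃ μ, (μ = a ∨ μ = b ∨ μ = c) ∧ a ≤ μ ∧ b ≤ μ ∧ c ≤ μ := by
  refine ⟨max a (max b c), ?_, by simp, by simp, by simp⟩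
  rcases max_choice a (max b c) with h | h
  · exact Or.inl h
  · rw [h]; exact Or.inr (max_choice b c)

theorem sq_add_sq_add_sq_le {a b c μ s : ℝ} (ha : 0 ≤ a) (hb : 0 ≤ b) (hc : 0 ≤ c)
    (ha' : a ≤ μ) (hb' : b ≤ μ) (hc' : c ≤ μ) (hs : a + b + c ≤ s) :
    a ^ 2 + b ^ 2 + c ^ 2 ≤ μ * s := by
  nlinarith [mul_nonneg ha (sub_nonneg.2 ha'), mul_nonneg hb (sub_nonneg.2 hb'),
    mul_nonneg hc (sub_nonneg.2 hc'), mul_nonneg (ha.trans ha') (sub_nonneg.2 hs)]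

/-- The sum of squares estimate when the largest weight is at `0`: among the points of largest
weight on the four lines through `0`, three are collinear. -/
theorem sum_sq_le_one_of_max_zero {w : ZMod 13 → ℝ} (hw : w ∈ weightPolytope)
    (hmax : ∀ i, w i ≤ w 0) : ∑ i, w i ^ 2 ≤ 1 := by
  obtain ⟨h0, hl⟩ := hw
  simp only [sum_singerLine] at hl
  have l0 := hl 0
  have l1 := hl 1
  have l2 := hl 2
  have l3 := hl 3
  have l4 := hl 4
  have l5 := hl 5
  have l6 := hl 6
  have l7 := hl 7
  have l8 := hl 8
  have l9 := hl 9
  have l10 := hl 10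
  have l11 := hl 11
  have l12 := hl 12
  rw [sum_zmod_thirteen]
  have n := h0
  have e10 : (4 : ZMod 13) + 9 = 0 := by decide
  have e11 : (5 : ZMod 13) + 9 = 1 := by decide
  have e12 : (6 : ZMod 13) + 9 = 2 := by decide
  have e13 : (7 : ZMod 13) + 9 = 3 := by decide
  have e14 : (8 : ZMod 13) + 9 = 4 := by decide
  have e15 : (9 : ZMod 13) + 9 = 5 := by decide
  have e16 : (10 : ZMod 13) + 9 = 6 := by decide
  have e17 : (11 : ZMod 13) + 9 = 7 := by decide
  have e18 : (12 : ZMod 13) + 9 = 8 := by decide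
  have e20 : (10 : ZMod 13) + 3 = 0 := by decide
  have e21 : (11 : ZMod 13) + 3 = 1 := by decide
  have e22 : (12 : ZMod 13) + 3 = 2 := by decide
  have e30 : (12 : ZMod 13) + 1 = 0 := by decide
  simp only [e10, e11, e12, e13, e14, e15, e16, e17, e18, e20, e21, e22, e30, zero_add]
    at l0 l4 l5 l6 l7 l8 l9 l10 l11 l12
  norm_num only at l1 l2 l3 l4 l5 l6 l7 l8 l9 l10 l11 l12
  obtain ⟨μ₁, c₁, a₁, b₁, d₁⟩ := exists_max_of_three (w 1) (w 3) (w 9)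
  obtain ⟨μ₂, c₂, a₂, b₂, d₂⟩ := exists_max_of_three (w 12) (w 2) (w 8)
  obtain ⟨μ₃, c₃, a₃, b₃, d₃⟩ := exists_max_of_three (w 10) (w 11) (w 6)
  obtain ⟨μ₄, c₄, a₄, b₄, d₄⟩ := exists_max_of_three (w 4) (w 5) (w 7)
  have q₁ := sq_add_sq_add_sq_le (s := 1 - w 0) (n _) (n _) (n _) a₁ b₁ d₁ (by linarith)
  have q₂ := sq_add_sq_add_sq_le (s := 1 - w 0) (n _) (n _) (n _) a₂ b₂ d₂ (by linarith)
  have q₃ := sq_add_sq_add_sq_le (s := 1 - w 0) (n _) (n _) (n _) a₃ b₃ d₃ (by linarith)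
  have q₄ := sq_add_sq_add_sq_le (s := 1 - w 0) (n _) (n _) (n _) a₄ b₄ d₄ (by linarith)
  -- With this, the sum of squares is at most `w 0 ² + (1 - w 0) * (1 + w 0) = 1`.
  have hμ : μ₁ + μ₂ + μ₃ + μ₄ ≤ 1 + w 0 := by
    clear q₁ q₂ q₃ q₄ a₁ b₁ d₁ a₂ b₂ d₂ a₃ b₃ d₃ a₄ b₄ d₄
    have n1 := n 1
    have n2 := n 2
    have n3 := n 3
    have n4 := n 4
    have n5 := n 5
    have n6 := n 6
    have n7 := n 7
    have n8 := n 8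
    have n9 := n 9
    have n10 := n 10
    have n11 := n 11
    have n12 := n 12
    have m1 := hmax 1
    have m2 := hmax 2
    have m3 := hmax 3
    have m4 := hmax 4
    have m5 := hmax 5
    have m6 := hmax 6
    have m7 := hmax 7
    have m8 := hmax 8
    have m9 := hmax 9
    have m10 := hmax 10
    have m11 := hmax 11
    have m12 := hmax 12
    -- An arc in the plane of order three has at most four points, so the point `0` and one further
    -- point on each line through it cannot form a 5-arc. Hence three of the four chosen points lie
    -- on a line and weigh at most one together; the fourth weighs at most `w 0`. The 81 choices are
    -- checked one by one.
    rcases c₁ with rfl | rfl | rfl <;> rcases c₂ with rfl | rfl | rfl <;>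
      rcases c₃ with rfl | rfl | rfl <;> rcases c₄ with rfl | rfl | rfl <;> linarith
  have hw0 : w 0 ≤ 1 := by linarith [n 1, n 3, n 9]
  nlinarith [mul_le_mul_of_nonneg_left hμ (sub_nonneg.2 hw0)]

/-- Translations of `ZMod 13` permute the lines, so the largest weight can be moved to `0`. -/
theorem sum_sq_le_one {z : ZMod 13 → ℝ} (hz : z ∈ weightPolytope) : ∑ i, z i ^ 2 ≤ 1 := by
  obtain ⟨p, hp⟩ := Finite.exists_max z
  have key : ∑ i, z (p + i) ^ 2 ≤ 1 := by
    refine sum_sq_le_one_of_max_zero (w := fun i => z (p + i)) ⟨fun i => hz.1 _, fun l => ?_⟩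
      fun i => by simpa using hp _
    have := hz.2 (p + l)
    rw [sum_singerLine] at this ⊢
    simpa [add_assoc] using this
  rwa [← Equiv.sum_comp (Equiv.addLeft p) fun i => z i ^ 2]

/-! ## Integral vectors of norm at most one -/

theorem sum_mul_le_of_sum_sq_le {ι : Type*} [Fintype ι] {c z : ι → ℝ} {a : ℝ} (ha : 0 ≤ a)
    (hc : ∑ i, c i ^ 2 ≤ a ^ 2) (hz : ∑ i, z i ^ 2 ≤ 1) : ∑ i, c i * z i ≤ a := by
  refine abs_le_of_sq_le_sq' ?_ ha |>.2
  calc (∑ i, c i * z i) ^ 2 ≤ (∑ i, c i ^ 2) * ∑ i, z i ^ 2 :=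
        Finset.sum_mul_sq_le_sq_mul_sq _ _ _
    _ ≤ a ^ 2 * 1 := by gcongr
    _ = a ^ 2 := mul_one _

/-- Dividing `c` by `a` gives a weight, so both vectors obey the sum of squares bound and
Cauchy-Schwarz applies. Working with every `a' > a` avoids dividing by `a = 0`. -/
theorem sum_mul_le_of_smul_polytope {c z : ZMod 13 → ℝ} {a : ℝ} (hc : ∀ i, 0 ≤ c i)
    (hl : ∀ l, ∑ i ∈ singerLine l, c i ≤ a) (hz : z ∈ weightPolytope) : ∑ i, c i * z i ≤ a := by
  have ha : 0 ≤ a := (Finset.sum_nonneg fun i _ => hc i).trans (hl 0)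
  have main : ∀ a' > a, ∑ i, c i * z i ≤ a' := by
    intro a' haa
    have ha' : 0 < a' := ha.trans_lt haa
    have h := sum_sq_le_one (z := fun i => c i / a') ⟨fun i => div_nonneg (hc i) ha'.le,
      fun l => by rw [← Finset.sum_div, div_le_one ha']; exact (hl l).trans haa.le⟩
    refine sum_mul_le_of_sum_sq_le ha'.le ?_ (sum_sq_le_one hz)
    simp only [div_pow] at h
    rwa [← Finset.sum_div, div_le_one (by positivity)] at h
  exact le_of_forall_gt_imp_ge_of_dense main

theorem sum_ite_mem_finset {M : Type*} [AddCommMonoid M] (T : Finset (ZMod 13))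
    (g : ZMod 13 → M) : ∑ i, (if i ∈ T then g i else 0) = ∑ i ∈ T, g i := by
  simp

/-- Removing a line from a nonnegative integral vector, and replacing negative entries by zero. -/
def removeLine (b : ZMod 13 → ℤ) (l : ZMod 13) (i : ZMod 13) : ℤ :=
  if i ∈ singerLine l then max (b i - 1) 0 else b i

theorem removeLine_nonneg {b : ZMod 13 → ℤ} (hb : ∀ i, 0 ≤ b i) (l i : ZMod 13) :
    0 ≤ removeLine b l i := by
  unfold removeLine
  split_ifs
  · exact le_max_right _ _
  · exact hb i

theorem sum_sq_removeLine (b : ZMod 13 → ℤ) (l : ZMod 13) :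
    ∑ i, removeLine b l i ^ 2 =
      ∑ i, b i ^ 2 + ∑ i ∈ singerLine l, (max (b i - 1) 0 ^ 2 - b i ^ 2) := by
  rw [← sum_ite_mem_finset (singerLine l), ← Finset.sum_add_distrib]
  refine Finset.sum_congr rfl fun i _ => ?_
  unfold removeLine
  split_ifs <;> ring

theorem sum_mul_le_removeLine {z : ZMod 13 → ℝ} (hz : z ∈ weightPolytope) (b : ZMod 13 → ℤ)
    (l : ZMod 13) : ∑ i, (b i : ℝ) * z i ≤ ∑ i, (removeLine b l i : ℝ) * z i + 1 := by
  have h : ∑ i, (b i : ℝ) * z i ≤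
      ∑ i, ((removeLine b l i : ℝ) * z i + if i ∈ singerLine l then z i else 0) := by
    refine Finset.sum_le_sum fun i _ => ?_
    unfold removeLine
    split_ifs
    · have : (b i : ℝ) - 1 ≤ ((max (b i - 1) 0 : ℤ) : ℝ) := by
        exact_mod_cast le_max_left (b i - 1) 0
      nlinarith [hz.1 i]
    · simp
  rw [Finset.sum_add_distrib, sum_ite_mem_finset] at h
  linarith [hz.2 l]

theorem sq_max_sub_one_le {x : ℤ} (hx : 0 ≤ x) : max (x - 1) 0 ^ 2 - x ^ 2 ≤ -x := by
  rcases hx.eq_or_lt with rfl | h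
  · simp
  · rw [max_eq_left (by omega)]; nlinarith

theorem sq_max_sub_one_le' {x : ℤ} (hx : 0 ≤ x) :
    max (x - 1) 0 ^ 2 - x ^ 2 ≤ -2 * x + 1 := by
  rcases hx.eq_or_lt with rfl | h
  · simp
  · rw [max_eq_left (by omega)]; nlinarith

theorem card_singerLine (l : ZMod 13) : (singerLine l).card = 4 := by
  simpa using card_singerLine_inter l l

theorem sum_sq_removeLine_le {b : ZMod 13 → ℤ} (hb : ∀ i, 0 ≤ b i) (l : ZMod 13) :
    ∑ i, removeLine b l i ^ 2 ≤ ∑ i, b i ^ 2 - ∑ i ∈ singerLine l, b i := by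
  rw [sum_sq_removeLine, sub_eq_add_neg, ← Finset.sum_neg_distrib]
  gcongr with i
  exact sq_max_sub_one_le (hb i)

theorem sum_sq_removeLine_le_add_four {b : ZMod 13 → ℤ} (hb : ∀ i, 0 ≤ b i) (l : ZMod 13) :
    ∑ i, removeLine b l i ^ 2 ≤ ∑ i, b i ^ 2 - 2 * ∑ i ∈ singerLine l, b i + 4 := by
  have h : ∑ i ∈ singerLine l, (max (b i - 1) 0 ^ 2 - b i ^ 2) ≤
      ∑ i ∈ singerLine l, (-2 * b i + 1) :=
    Finset.sum_le_sum fun i _ => sq_max_sub_one_le' (hb i)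
  rw [sum_sq_removeLine]
  simp only [Finset.sum_add_distrib, Finset.sum_sub_distrib, ← Finset.mul_sum, Finset.sum_const,
    card_singerLine, nsmul_eq_mul, Nat.cast_ofNat, mul_one] at h ⊢
  linarith

/-- Truncation leaves a zero entry unchanged, which gains one over the general estimate. -/
theorem sum_sq_removeLine_le_add_three {b : ZMod 13 → ℤ} (hb : ∀ i, 0 ≤ b i) {l p : ZMod 13}
    (hp : p ∈ singerLine l) (hbp : b p = 0) :
    ∑ i, removeLine b l i ^ 2 ≤ ∑ i, b i ^ 2 - 2 * ∑ i ∈ singerLine l, b i + 3 := by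
  have h : ∑ i ∈ singerLine l, (max (b i - 1) 0 ^ 2 - b i ^ 2) ≤
      ∑ i ∈ singerLine l, (-2 * b i + (1 - if i = p then 1 else 0)) := by
    refine Finset.sum_le_sum fun i _ => ?_
    split_ifs with h
    · subst h; simp [hbp]
    · simpa using sq_max_sub_one_le' (hb i)
  rw [sum_sq_removeLine]
  simp only [Finset.sum_add_distrib, Finset.sum_sub_distrib, ← Finset.mul_sum, Finset.sum_const,
    card_singerLine, nsmul_eq_mul, Nat.cast_ofNat, mul_one, Finset.sum_ite_eq', hp, if_true] at h ⊢
  linarith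

/-- The vector obtained by subtracting one third of each line in `T`. -/
noncomputable def removeThirds (b : ZMod 13 → ℤ) (T : Finset (ZMod 13)) (i : ZMod 13) : ℝ :=
  b i - (1 / 3) * ∑ l ∈ T, if i ∈ singerLine l then 1 else 0

theorem sum_removeThirds_mul (b : ZMod 13 → ℤ) (T : Finset (ZMod 13)) (z : ZMod 13 → ℝ) :
    ∑ i, removeThirds b T i * z i =
      ∑ i, (b i : ℝ) * z i - (1 / 3) * ∑ l ∈ T, ∑ i ∈ singerLine l, z i := by
  simp only [← sum_ite_mem_finset (singerLine _)]
  rw [Finset.sum_comm, Finset.mul_sum, ← Finset.sum_sub_distrib]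
  refine Finset.sum_congr rfl fun i _ => ?_
  rw [removeThirds, sub_mul, mul_assoc, Finset.sum_mul]
  simp only [ite_mul, one_mul, zero_mul]

/-- Two lines share one point or all four, that is `1 + 3δ`, so a third of each line in `T` lowers
every line sum by `T.card / 3`, and by one more on the lines of `T`. -/
theorem sum_line_removeThirds (b : ZMod 13 → ℤ) (T : Finset (ZMod 13)) (m : ZMod 13) :
    ∑ i ∈ singerLine m, removeThirds b T i =
      ((∑ i ∈ singerLine m, b i : ℤ) : ℝ) - T.card / 3 - if m ∈ T then 1 else 0 := by
  have h : ∑ i ∈ singerLine m, ∑ l ∈ T, (if i ∈ singerLine l then (1 : ℝ) else 0) =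
      T.card + 3 * if m ∈ T then 1 else 0 := by
    rw [Finset.sum_comm]
    have h1 : ∀ l, ∑ i ∈ singerLine m, (if i ∈ singerLine l then (1 : ℝ) else 0) =
        1 + 3 * if m = l then 1 else 0 := by
      intro l
      rw [Finset.sum_boole, Finset.filter_mem_eq_inter, card_singerLine_inter]
      split_ifs <;> norm_num
    simp only [h1, Finset.sum_add_distrib, ← Finset.mul_sum, Finset.sum_ite_eq, Finset.sum_const,
      nsmul_eq_mul, mul_one]
  simp only [removeThirds]
  rw [Finset.sum_sub_distrib, ← Finset.mul_sum, h]
  push_cast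
  ring

theorem sum_sq_removeThirds (b : ZMod 13 → ℤ) (T : Finset (ZMod 13)) {s : ℤ}
    (hT : ∀ l ∈ T, ∑ i ∈ singerLine l, b i = s) :
    ∑ i, removeThirds b T i ^ 2 =
      ((∑ i, b i ^ 2 : ℤ) : ℝ) - (2 / 3) * T.card * s + T.card * (T.card + 3) / 9 := by
  have h1 : ∑ l ∈ T, ∑ i ∈ singerLine l, removeThirds b T i =
      T.card * (s - T.card / 3 - 1) := by
    rw [Finset.sum_congr rfl fun l hl => by rw [sum_line_removeThirds, hT l hl, if_pos hl],
      Finset.sum_const, nsmul_eq_mul]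
  have h2 : ∑ l ∈ T, ∑ i ∈ singerLine l, (b i : ℝ) = T.card * s := by
    rw [Finset.sum_congr rfl fun l hl => by rw [← Int.cast_sum, hT l hl]]
    simp
  have h3 := sum_removeThirds_mul b T (removeThirds b T)
  have h4 := sum_removeThirds_mul b T fun i => (b i : ℝ)
  rw [h1] at h3
  rw [h2] at h4
  have h5 : ∑ i, (b i : ℝ) * removeThirds b T i = ∑ i, removeThirds b T i * (b i : ℝ) :=
    Finset.sum_congr rfl fun i _ => mul_comm _ _
  simp only [pow_two]
  rw [h3, h5, h4]
  push_cast
  ring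

theorem removeThirds_nonneg {b : ZMod 13 → ℤ} {T : Finset (ZMod 13)} (hb : ∀ i, 0 ≤ b i)
    (hT : ∀ l ∈ T, ∀ i ∈ singerLine l, b i ≠ 0) (hcard : T.card ≤ 3) (i : ZMod 13) :
    0 ≤ removeThirds b T i := by
  unfold removeThirds
  by_cases h : ∃ l ∈ T, i ∈ singerLine l
  · obtain ⟨l, hl, hi⟩ := h
    have h1 : (1 : ℝ) ≤ b i := by
      exact_mod_cast Int.add_one_le_of_lt ((hb i).lt_of_ne' (hT l hl i hi))
    have h2 : (T.card : ℝ) ≤ 3 := by exact_mod_cast hcard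
    have h3 : ∑ l ∈ T, (if i ∈ singerLine l then (1 : ℝ) else 0) ≤ T.card := by
      rw [Finset.sum_boole]
      exact_mod_cast Finset.card_filter_le _ _
    linarith
  · push Not at h
    rw [Finset.sum_eq_zero fun l hl => if_neg (h l hl)]
    simpa using hb i

/-- The term `min a 1` makes the bound zero at `a = 0`: a single unit entry would violate the
conclusion there. -/
theorem sum_int_mul_le {z : ZMod 13 → ℝ} (hz : z ∈ weightPolytope) (a : ℕ) :
    ∀ b : ZMod 13 → ℤ, (∀ i, 0 ≤ b i) → ∑ i, b i ^ 2 ≤ (a : ℤ) ^ 2 + min (a : ℤ) 1 →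
      ∑ i, (b i : ℝ) * z i ≤ a := by
  have hz2 := sum_sq_le_one hz
  induction a with
  | zero =>
    intro b _ h
    refine sum_mul_le_of_sum_sq_le (by simp) ?_ hz2
    have h' : ∑ i, b i ^ 2 ≤ 0 := by simpa using h
    simpa using (by exact_mod_cast h' : ∑ i, (b i : ℝ) ^ 2 ≤ 0)
  | succ a ih =>
    intro b hb h
    have hmin : min ((a + 1 : ℕ) : ℤ) 1 = 1 := min_eq_right (by omega)
    rw [hmin] at h
    push_cast at h ⊢
    -- A line this heavy can be removed outright: the remaining sum of squares is at most `(a+1)² +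
    -- 1 - 2(a+3) + 4 = a²`, and the line itself contributes at most one.
    by_cases h1 : ∃ l, (a : ℤ) + 3 ≤ ∑ i ∈ singerLine l, b i
    · obtain ⟨l, hl⟩ := h1
      have h2 := sum_sq_removeLine_le_add_four hb l
      have h3 : ∑ i, removeLine b l i ^ 2 ≤ (a : ℤ) ^ 2 := by linarith
      have h4 := sum_mul_le_of_sum_sq_le (c := fun i => (removeLine b l i : ℝ))
        (Nat.cast_nonneg a) (by exact_mod_cast h3) hz2
      linarith [sum_mul_le_removeLine hz b l]
    push Not at h1
    by_cases h2 : ∃ l, ∑ i ∈ singerLine l, b i = a + 2 ∧ ∃ p ∈ singerLine l, b p = 0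
    · obtain ⟨l, hl, p, hp, hbp⟩ := h2
      -- For `a ≥ 1` the second estimate gives `a² + 1`. At `a = 0` the induction hypothesis asks
      -- for `0`, which only the first one provides.
      have h3 := sum_sq_removeLine_le hb l
      have h4 := sum_sq_removeLine_le_add_three hb hp hbp
      have h5 := ih (removeLine b l) (removeLine_nonneg hb l) (by
        rcases le_total (a : ℤ) 1 with h | h
        · rw [min_eq_left h]; nlinarith
        · rw [min_eq_right h]; nlinarith)
      linarith [sum_mul_le_removeLine hz b l]
    push Not at h2
    -- Now no line sum exceeds `a + 2`, and the lines attaining it, collected in `O`, have only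
    -- positive entries.
    set O : Finset (ZMod 13) := {l | ∑ i ∈ singerLine l, b i = (a : ℤ) + 2} with hO
    obtain ⟨T, hTO, hT⟩ : ∃ T ⊆ O, T.card = 3 ∨ T.card ≤ 3 ∧ T = O := by
      rcases le_total 3 O.card with h | h
      · obtain ⟨T, hTO, hT⟩ := Finset.exists_subset_card_eq h
        exact ⟨T, hTO, Or.inl hT⟩
      · exact ⟨O, subset_rfl, Or.inr ⟨h, rfl⟩⟩
    have hTs : ∀ l ∈ T, ∑ i ∈ singerLine l, b i = (a : ℤ) + 2 := fun l hl => by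
      simpa [hO] using hTO hl
    have hsub : (1 / 3 : ℝ) * ∑ l ∈ T, ∑ i ∈ singerLine l, z i ≤ T.card / 3 := by
      have := Finset.sum_le_card_nsmul T (fun l => ∑ i ∈ singerLine l, z i) 1 fun l _ => hz.2 l
      simp only [nsmul_eq_mul, mul_one] at this
      linarith
    have hmul := sum_removeThirds_mul b T z
    -- Subtracting thirds of three lines of `O` leaves sum of squares at most `(a+1)² + 1 - 2(a+2) +
    -- 2 = a²`, so Cauchy-Schwarz suffices. Otherwise all of `O` is used: the result is nonnegative
    -- with every line sum at most `a + 1 - T.card / 3`, hence a multiple of a weight.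
    rcases hT with hT | ⟨hT, hTeq⟩
    · have h3 := sum_sq_removeThirds b T hTs
      have hR : ((∑ i, b i ^ 2 : ℤ) : ℝ) ≤ ((a : ℝ) + 1) ^ 2 + 1 := by exact_mod_cast h
      rw [hT] at h3 hsub
      have h4 := sum_mul_le_of_sum_sq_le (c := removeThirds b T) (Nat.cast_nonneg a)
        (by rw [h3]; push_cast at hR ⊢; linarith) hz2
      push_cast at hsub
      linarith
    · have h4 : ∑ i, removeThirds b T i * z i ≤ (a : ℝ) + 1 - T.card / 3 := by
        refine sum_mul_le_of_smul_polytope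
          (removeThirds_nonneg hb (fun l hl => h2 l (hTs l hl)) hT) (fun l => ?_) hz
        rw [sum_line_removeThirds]
        split_ifs with hl
        · rw [hTs l hl]; push_cast; linarith
        · have h5 : ∑ i ∈ singerLine l, b i ≤ (a : ℤ) + 1 := by
            have h6 : ∑ i ∈ singerLine l, b i ≠ (a : ℤ) + 2 := fun h => hl (by simp [hTeq, hO, h])
            have := h1 l
            omega
          have h7 : ((∑ i ∈ singerLine l, b i : ℤ) : ℝ) ≤ (a : ℝ) + 1 := by exact_mod_cast h5
          linarith
      linarith

/-! ## Coordinates on the projective plane of order three -/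

/-- The powers `1, ω, …, ω¹²` in `𝔽₂₇ = 𝔽₃[ω] / (ω³ - ω - 1)`, in the basis `1, ω, ω²`. -/
def singerPointRep : Fin 13 → Fin 3 → ZMod 3 :=
  ![![1, 0, 0], ![0, 1, 0], ![0, 0, 1], ![1, 1, 0], ![0, 1, 1], ![1, 1, 1],
    ![1, 2, 1], ![1, 2, 2], ![2, 0, 2], ![2, 1, 0], ![0, 2, 1], ![1, 1, 2],
    ![2, 0, 1]]

/-- The equations of the lines spanned by `ωˡ` and `ωˡ⁺¹`. -/
def singerLineRep : Fin 13 → Fin 3 → ZMod 3 :=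
  ![![0, 0, 1], ![1, 0, 0], ![2, 1, 0], ![1, 2, 1], ![0, 1, 2], ![2, 0, 1],
    ![2, 2, 0], ![1, 2, 2], ![1, 1, 2], ![1, 1, 1], ![0, 1, 1], ![1, 0, 1],
    ![0, 1, 0]]

theorem singerPointRep_ne_zero : ∀ i, singerPointRep i ≠ 0 := by decide
theorem singerLineRep_ne_zero : ∀ i, singerLineRep i ≠ 0 := by decide

def singerPoint (i : ZMod 13) : PlanePoint :=
  Projectivization.mk (ZMod 3) (singerPointRep i) (singerPointRep_ne_zero i)

def singerPlaneLine (l : ZMod 13) : PlaneLine :=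
  Projectivization.mk (ZMod 3) (singerLineRep l) (singerLineRep_ne_zero l)

/-- The line through `1` and `ω` also contains `ω³ = ω + 1` and `ω⁹ = ω + 2`, whence `{0, 1, 3, 9}`;
multiplication by `ω` translates it. -/
theorem singerPoint_mem_iff (i l : ZMod 13) :
    singerPoint i ∈ singerPlaneLine l ↔ i ∈ singerLine l := by
  rw [Configuration.ofField.mem_iff, singerPoint, singerPlaneLine, Projectivization.orthogonal_mk,
    dotProduct, Fin.sum_univ_three]
  revert i l
  decide

theorem mk_bijective_of_forall {r : Fin 13 → Fin 3 → ZMod 3} (h0 : ∀ i, r i ≠ 0)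
    (hinj : ∀ i j, ∀ a : ZMod 3, a • r j = r i → i = j)
    (hsurj : ∀ x y z : ZMod 3, ![x, y, z] ≠ 0 → ∃ i, ∃ a : ZMod 3, a • ![x, y, z] = r i) :
    Function.Bijective fun i : ZMod 13 => Projectivization.mk (ZMod 3) (r i) (h0 i) := by
  constructor
  · intro i j h
    obtain ⟨a, ha⟩ := (Projectivization.mk_eq_mk_iff' _ _ _ _ _).1 h
    exact hinj i j a ha
  · intro p
    induction p using Projectivization.ind with
    | h v hv =>
      have hv' : v = ![v 0, v 1, v 2] := by ext i; fin_cases i <;> rfl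
      obtain ⟨i, a, h⟩ := hsurj (v 0) (v 1) (v 2) (hv' ▸ hv)
      exact ⟨i, (Projectivization.mk_eq_mk_iff' _ _ _ _ _).2 ⟨a, by rw [hv', h]⟩⟩

theorem singerPoint_bijective : Function.Bijective singerPoint :=
  mk_bijective_of_forall singerPointRep_ne_zero (by decide) (by decide)

theorem singerPlaneLine_bijective : Function.Bijective singerPlaneLine :=
  mk_bijective_of_forall singerLineRep_ne_zero (by decide) (by decide)

/-! ## The roots in coordinates -/

/-- The coordinates of Lorentzian space, indexed by the cyclic model. -/
noncomputable def singerIndex (σ : PlanePoint ≃ Fin 13) : ZMod 13 ≃ Fin 13 :=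
  (Equiv.ofBijective _ singerPoint_bijective).trans σ

theorem lorentzInner_eq_sum_singer (σ : PlanePoint ≃ Fin 13) (x y : LorentzSpace 13) :
    lorentzInner x y =
      -(x 0 * y 0) + ∑ i, x (singerIndex σ i).succ * y (singerIndex σ i).succ := by
  rw [lorentzInner, Equiv.sum_comp (singerIndex σ) fun i => x i.succ * y i.succ]

theorem pointRoot_zero (σ : PlanePoint ≃ Fin 13) (p : PlanePoint) : pointRoot σ p 0 = 0 :=
  by simp [pointRoot, lorentzBasis]

theorem pointRoot_succ (σ : PlanePoint ≃ Fin 13) (i j : ZMod 13) :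
    pointRoot σ (singerPoint i) (singerIndex σ j).succ = if j = i then 1 else 0 := by
  have h : σ (singerPoint i) = singerIndex σ i := rfl
  simp [pointRoot, lorentzBasis, Pi.single_apply, h, Fin.succ_inj]

theorem lineRoot_zero (σ : PlanePoint ≃ Fin 13) (l : PlaneLine) : lineRoot σ l 0 = 1 := by
  simp only [lineRoot, Pi.sub_apply, Finset.sum_apply]
  rw [Finset.sum_eq_zero]
  · simp [lorentzBasis]
  · intro i _
    split_ifs
    · exact pointRoot_zero σ _
    · rfl

theorem lineRoot_succ (σ : PlanePoint ≃ Fin 13) (l i : ZMod 13) :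
    lineRoot σ (singerPlaneLine l) (singerIndex σ i).succ =
      -if i ∈ singerLine l then 1 else 0 := by
  simp only [lineRoot, Pi.sub_apply, Finset.sum_apply]
  rw [← Equiv.sum_comp (singerIndex σ)]
  have h : ∀ j, σ.symm (singerIndex σ j) = singerPoint j := fun j => by simp [singerIndex]
  simp only [h, singerPoint_mem_iff, ite_apply, pointRoot_succ,
    Pi.zero_apply]
  rw [Finset.sum_eq_single i]
  · simp [lorentzBasis]
  · intro j _ hj
    simp [hj.symm]
  · simp

theorem lorentzInner_pointRoot (σ : PlanePoint ≃ Fin 13) (x : LorentzSpace 13) (i : ZMod 13) :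
    lorentzInner x (pointRoot σ (singerPoint i)) = x (singerIndex σ i).succ := by
  simp [lorentzInner_eq_sum_singer σ, pointRoot_zero, pointRoot_succ]

theorem lorentzInner_lineRoot (σ : PlanePoint ≃ Fin 13) (x : LorentzSpace 13) (l : ZMod 13) :
    lorentzInner x (lineRoot σ (singerPlaneLine l)) =
      -x 0 - ∑ i ∈ singerLine l, x (singerIndex σ i).succ := by
  simp [lorentzInner_eq_sum_singer σ, lineRoot_zero, lineRoot_succ, sub_eq_add_neg]

theorem lorentzInner_pointRoot_pointRoot (σ : PlanePoint ≃ Fin 13) (p q : PlanePoint) :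
    (p = q → lorentzInner (pointRoot σ p) (pointRoot σ q) = 1) ∧
      (p ≠ q → lorentzInner (pointRoot σ p) (pointRoot σ q) = 0) := by
  obtain ⟨i, rfl⟩ := singerPoint_bijective.2 p
  obtain ⟨j, rfl⟩ := singerPoint_bijective.2 q
  rw [singerPoint_bijective.1.ne_iff, singerPoint_bijective.1.eq_iff, lorentzInner_pointRoot,
    pointRoot_succ]
  exact ⟨fun h => if_pos h.symm, fun h => if_neg h.symm⟩

theorem lorentzInner_lineRoot_lineRoot (σ : PlanePoint ≃ Fin 13) (l m : PlaneLine) :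
    (l = m → lorentzInner (lineRoot σ l) (lineRoot σ m) = 3) ∧
      (l ≠ m → lorentzInner (lineRoot σ l) (lineRoot σ m) = 0) := by
  obtain ⟨i, rfl⟩ := singerPlaneLine_bijective.2 l
  obtain ⟨j, rfl⟩ := singerPlaneLine_bijective.2 m
  rw [singerPlaneLine_bijective.1.ne_iff, singerPlaneLine_bijective.1.eq_iff,
    lorentzInner_lineRoot, lineRoot_zero]
  simp only [lineRoot_succ]
  rw [Finset.sum_neg_distrib, Finset.sum_boole, Finset.filter_mem_eq_inter, card_singerLine_inter]
  constructor
  · rintro rfl; norm_num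
  · intro h; rw [if_neg (Ne.symm h)]; norm_num

theorem lorentzInner_pointRoot_lineRoot (σ : PlanePoint ≃ Fin 13) (p : PlanePoint)
    (l : PlaneLine) :
    (p ∈ l → lorentzInner (pointRoot σ p) (lineRoot σ l) = -1) ∧
      (p ∉ l → lorentzInner (pointRoot σ p) (lineRoot σ l) = 0) := by
  obtain ⟨i, rfl⟩ := singerPoint_bijective.2 p
  obtain ⟨j, rfl⟩ := singerPlaneLine_bijective.2 l
  rw [lorentzInner_lineRoot, pointRoot_zero, singerPoint_mem_iff]
  simp only [pointRoot_succ, Finset.sum_ite_eq']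
  constructor <;> intro h <;> simp [h]

theorem mem_incidenceCone_iff (σ : PlanePoint ≃ Fin 13) (x : LorentzSpace 13) :
    x ∈ incidenceCone σ ↔ (∀ i, x (singerIndex σ i).succ ≤ 0) ∧
      ∀ l, -∑ i ∈ singerLine l, x (singerIndex σ i).succ ≤ x 0 := by
  refine and_congr (singerPoint_bijective.2.forall.trans (by simp only [lorentzInner_pointRoot]))
    (singerPlaneLine_bijective.2.forall.trans (forall_congr' fun l => ?_))
  rw [lorentzInner_lineRoot]
  constructor <;> intro h <;> linarith

/-! ## The incidence cone lies in the chamber -/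

/-- The points at which all inequalities defining the incidence cone are strict. -/
def openIncidenceCone (σ : PlanePoint ≃ Fin 13) : Set (LorentzSpace 13) :=
  {x | (∀ i, x (singerIndex σ i).succ < 0) ∧
    ∀ l, -∑ i ∈ singerLine l, x (singerIndex σ i).succ < x 0}

theorem openIncidenceCone_pos {σ : PlanePoint ≃ Fin 13} {x : LorentzSpace 13}
    (hx : x ∈ openIncidenceCone σ) : 0 < x 0 := by
  refine lt_of_le_of_lt ?_ (hx.2 0)
  rw [neg_nonneg]
  exact Finset.sum_nonpos fun i _ => (hx.1 i).le

/-- A point of the open cone, scaled to lie in the weight polytope with room to spare. -/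
theorem exists_weight_of_mem_openIncidenceCone {σ : PlanePoint ≃ Fin 13} {x : LorentzSpace 13}
    (hx : x ∈ openIncidenceCone σ) : ∃ t, 0 < t ∧ t < x 0 ∧
      (fun i => -x (singerIndex σ i).succ / t) ∈ weightPolytope := by
  obtain ⟨l, hl⟩ := Finite.exists_max fun l => -∑ i ∈ singerLine l, x (singerIndex σ i).succ
  have h0 : 0 ≤ -∑ i ∈ singerLine l, x (singerIndex σ i).succ :=
    neg_nonneg.2 (Finset.sum_nonpos fun i _ => (hx.1 i).le)
  obtain ⟨t, ht, ht'⟩ := exists_between (hx.2 l)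
  have ht0 := h0.trans_lt ht
  refine ⟨t, ht0, ht', fun i => div_nonneg (neg_nonneg.2 (hx.1 i).le) ht0.le, fun m => ?_⟩
  rw [← Finset.sum_div, div_le_one ht0, Finset.sum_neg_distrib]
  exact (hl m).trans ht.le

theorem openIncidenceCone_subset_forwardCone (σ : PlanePoint ≃ Fin 13) :
    openIncidenceCone σ ⊆ forwardCone 13 := by
  intro x hx
  refine ⟨?_, openIncidenceCone_pos hx⟩
  obtain ⟨t, ht0, htx, hz⟩ := exists_weight_of_mem_openIncidenceCone hx
  have h := sum_sq_le_one hz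
  simp only [div_pow, neg_sq] at h
  rw [← Finset.sum_div, div_le_one (by positivity)] at h
  rw [lorentzInner_eq_sum_singer σ]
  simp only [← pow_two]
  nlinarith

theorem lorentzInner_neg_of_mem_openIncidenceCone {σ : PlanePoint ≃ Fin 13}
    {x α : LorentzSpace 13} (hx : x ∈ openIncidenceCone σ) (hα : α ∈ normOneRoots 13)
    (h0 : 0 < α 0) : lorentzInner x α < 0 := by
  obtain ⟨t, ht0, htx, hz⟩ := exists_weight_of_mem_openIncidenceCone hx
  obtain ⟨hint, hnorm⟩ := hα
  choose m hm using hint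
  have hm0 : 0 < m 0 := by rw [hm 0] at h0; exact_mod_cast h0
  obtain ⟨a, ha⟩ := Int.eq_ofNat_of_zero_le hm0.le
  -- All coordinates of `x` after the zeroth are negative, so positive coordinates of `α` only help;
  -- dropping them does not increase the sum of squares.
  set b : ZMod 13 → ℤ := fun i => max (-m (singerIndex σ i).succ) 0 with hb
  have hsum : ∑ i, (m (singerIndex σ i).succ) ^ 2 = (a : ℤ) ^ 2 + 1 := by
    rw [lorentzInner_eq_sum_singer σ] at hnorm
    simp only [hm, ha] at hnorm
    have : -((a : ℤ) * a) + ∑ i, m (singerIndex σ i).succ * m (singerIndex σ i).succ = 1 := by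
      exact_mod_cast hnorm
    simp only [pow_two]
    linarith
  have hbsq : ∑ i, b i ^ 2 ≤ (a : ℤ) ^ 2 + min (a : ℤ) 1 := by
    rw [min_eq_right (by omega), ← hsum]
    refine Finset.sum_le_sum fun i _ => ?_
    rcases le_total (-m (singerIndex σ i).succ) 0 with h | h
    · simp only [hb, max_eq_right h]; positivity
    · simp only [hb, max_eq_left h]; simp
  have key := sum_int_mul_le hz a b (fun i => le_max_right _ _) hbsq
  simp only [mul_div_assoc'] at key
  rw [← Finset.sum_div, div_le_iff₀ ht0] at key
  have hle : ∑ i, x (singerIndex σ i).succ * α (singerIndex σ i).succ ≤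
      ∑ i, (b i : ℝ) * -x (singerIndex σ i).succ := by
    refine Finset.sum_le_sum fun i _ => ?_
    have h1 : -α (singerIndex σ i).succ ≤ b i := by
      rw [hm]; exact_mod_cast le_max_left _ _
    nlinarith [hx.1 i]
  rw [lorentzInner_eq_sum_singer σ]
  have ha0 : α 0 = a := by rw [hm, ha]; simp
  rw [ha0] at h0 ⊢
  -- Strictness comes from `t < x 0` and `a > 0`.
  nlinarith

/-- Such a root is plus or minus a basis vector, since its integral coordinates have squares summing
to one. -/
theorem lorentzInner_ne_zero_of_apply_zero {σ : PlanePoint ≃ Fin 13}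
    {x α : LorentzSpace 13} (hx : x ∈ openIncidenceCone σ) (hα : α ∈ normOneRoots 13)
    (h0 : α 0 = 0) : lorentzInner x α ≠ 0 := by
  obtain ⟨hint, hnorm⟩ := hα
  choose m hm using hint
  rw [lorentzInner_eq_sum_singer σ] at hnorm ⊢
  have hsum : ∑ i, (m (singerIndex σ i).succ) ^ 2 = 1 := by
    rw [h0, mul_zero, neg_zero, zero_add] at hnorm
    simp only [hm, ← pow_two] at hnorm
    exact_mod_cast hnorm
  obtain ⟨j, hj⟩ : ∃ j, m (singerIndex σ j).succ ≠ 0 := by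
    by_contra! h
    simp [h] at hsum
  have hz : ∀ i, i ≠ j → m (singerIndex σ i).succ = 0 := by
    intro i hi
    rw [← Finset.add_sum_erase _ _ (Finset.mem_univ j)] at hsum
    have h1 : m (singerIndex σ i).succ ^ 2 ≤
        ∑ i ∈ Finset.univ.erase j, m (singerIndex σ i).succ ^ 2 :=
      Finset.single_le_sum (f := fun i => m (singerIndex σ i).succ ^ 2)
        (fun _ _ => sq_nonneg _) (Finset.mem_erase.2 ⟨hi, Finset.mem_univ i⟩)
    have h2 : 0 < m (singerIndex σ j).succ ^ 2 := by positivity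
    have h3 : m (singerIndex σ i).succ ^ 2 ≤ 0 := by linarith [Int.add_one_le_of_lt h2]
    exact pow_eq_zero_iff two_ne_zero |>.1 (le_antisymm h3 (sq_nonneg _))
  rw [Finset.sum_eq_single j (fun i _ hi => by rw [hm, hz i hi]; simp) (by simp), h0, mul_zero,
    neg_zero, zero_add, hm (singerIndex σ j).succ]
  exact mul_ne_zero (hx.1 j).ne (by exact_mod_cast hj)

theorem openIncidenceCone_subset_mirrorComplement (σ : PlanePoint ≃ Fin 13) :
    openIncidenceCone σ ⊆ mirrorComplement 13 := by
  refine fun x hx => ⟨openIncidenceCone_subset_forwardCone σ hx, fun α hα => ?_⟩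
  rcases lt_trichotomy (α 0) 0 with h | h | h
  · have hneg : ∀ y : LorentzSpace 13, lorentzInner y (-α) = -lorentzInner y α := by
      intro y
      simp [lorentzInner, Finset.sum_neg_distrib]
      ring
    have hα' : -α ∈ normOneRoots 13 := by
      refine ⟨fun i => ?_, ?_⟩
      · obtain ⟨m, hm⟩ := hα.1 i
        exact ⟨-m, by simp [hm]⟩
      · rw [← hα.2]
        simp [lorentzInner]
    have := lorentzInner_neg_of_mem_openIncidenceCone hx hα' (by simpa using h)
    rw [hneg] at this
    exact (neg_lt_zero.1 this).ne'
  · exact lorentzInner_ne_zero_of_apply_zero hx hα h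
  · exact (lorentzInner_neg_of_mem_openIncidenceCone hx hα h).ne

theorem convex_openIncidenceCone (σ : PlanePoint ≃ Fin 13) : Convex ℝ (openIncidenceCone σ) := by
  have h : openIncidenceCone σ = (⋂ i, {x | x (singerIndex σ i).succ < 0}) ∩
      ⋂ l, {x | -∑ i ∈ singerLine l, x (singerIndex σ i).succ - x 0 < 0} := by
    ext x
    simp [openIncidenceCone]
  rw [h]
  refine (convex_iInter fun i => convex_halfSpace_lt ⟨fun _ _ => rfl, fun _ _ => rfl⟩ _).inter
    (convex_iInter fun l => convex_halfSpace_lt ⟨fun x y => ?_, fun c x => ?_⟩ _)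
  · simp only [Pi.add_apply, Finset.sum_add_distrib]; ring
  · simp only [Pi.smul_apply, smul_eq_mul, ← Finset.mul_sum]; ring

theorem basis_sub_sum_mem_openIncidenceCone (σ : PlanePoint ≃ Fin 13) {ε : Fin 13 → ℝ}
    (hε : ∀ i, 0 < ε i ∧ ε i < 1 / 8) :
    lorentzBasis 0 - ∑ i : Fin 13, ε i • lorentzBasis i.succ ∈ openIncidenceCone σ := by
  have h0 : (lorentzBasis 0 - ∑ i : Fin 13, ε i • lorentzBasis i.succ : LorentzSpace 13) 0 = 1 := by
    simp [lorentzBasis]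
  have hs : ∀ j : Fin 13,
      (lorentzBasis 0 - ∑ i : Fin 13, ε i • lorentzBasis i.succ : LorentzSpace 13) j.succ =
        -ε j := by
    intro j
    simp [lorentzBasis, Pi.single_apply]
  refine ⟨fun i => ?_, fun l => ?_⟩
  · rw [hs]; linarith [(hε (singerIndex σ i)).1]
  · simp only [h0, hs]
    rw [sum_singerLine]
    linarith [(hε (singerIndex σ l)).2, (hε (singerIndex σ (l + 1))).2,
      (hε (singerIndex σ (l + 3))).2, (hε (singerIndex σ (l + 9))).2]

theorem openIncidenceCone_subset_openNormOneChamber (σ : PlanePoint ≃ Fin 13) :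
    openIncidenceCone σ ⊆ openNormOneChamber 13 := fun x hx =>
  ⟨1 / 8, by norm_num, fun _ _ hε =>
    (convex_openIncidenceCone σ).isPreconnected.subset_connectedComponentIn hx
      (openIncidenceCone_subset_mirrorComplement σ) (basis_sub_sum_mem_openIncidenceCone σ hε)⟩

theorem incidenceCone_subset_normOneChamber (σ : PlanePoint ≃ Fin 13) :
    incidenceCone σ ⊆ normOneChamber 13 := by
  intro x hx
  rw [mem_incidenceCone_iff] at hx
  refine closure_mono (openIncidenceCone_subset_openNormOneChamber σ) ?_
  obtain ⟨y, hy⟩ : (openIncidenceCone σ).Nonempty :=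
    ⟨_, basis_sub_sum_mem_openIncidenceCone σ (ε := fun _ => 1 / 16) fun _ => by norm_num⟩
  have hlim : Filter.Tendsto (fun s : ℝ => x + s • y) (nhdsWithin 0 (Set.Ioi 0)) (nhds x) := by
    have : Continuous fun s : ℝ => x + s • y := by fun_prop
    simpa using (this.tendsto 0).mono_left nhdsWithin_le_nhds
  refine mem_closure_of_tendsto hlim (Filter.mem_of_superset self_mem_nhdsWithin ?_)
  intro s (hs : 0 < s)
  refine ⟨fun i => ?_, fun l => ?_⟩
  · have := mul_neg_of_pos_of_neg hs (hy.1 i)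
    simp only [Pi.add_apply, Pi.smul_apply, smul_eq_mul]
    linarith [hx.1 i]
  · have := mul_lt_mul_of_pos_left (hy.2 l) hs
    simp only [Pi.add_apply, Pi.smul_apply, smul_eq_mul, Finset.sum_add_distrib, ← Finset.mul_sum]
    linarith [hx.2 l]

/-! ## Finite volume of polytopes with ideal vertices -/

/-- An extreme point is determined by its set of active constraints: if `y` satisfies the equalities
holding at `x`, the segment from `y` to `x` extends slightly beyond `x` inside the polyhedron, which
forces `x = y`. -/
theorem finite_extremePoints_of_halfSpaces {E J : Type*} [AddCommGroup E] [Module ℝ E] [Finite J]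
    (f : J → E →ₗ[ℝ] ℝ) (c : J → ℝ) : ({y | ∀ j, f j y ≤ c j}.extremePoints ℝ).Finite := by
  refine Set.Finite.of_finite_image (f := fun y => {j | f j y = c j}) (Set.toFinite _) ?_
  intro x hx y hy hxy
  have hact : ∀ j, f j x = c j → f j y = c j := fun j h => (Set.ext_iff.1 hxy j).1 h
  have hev : ∀ᶠ δ : ℝ in nhdsWithin 0 (Set.Ioi 0), ∀ j, f j (x + δ • (x - y)) ≤ c j := by
    refine Filter.eventually_all.2 fun j => ?_
    simp only [map_add, map_smul, map_sub, smul_eq_mul]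
    rcases (hx.1 j).eq_or_lt with h | h
    · exact Filter.Eventually.of_forall fun δ => by rw [h, hact j h]; simp
    · have hcont : Continuous fun δ : ℝ => f j x + δ * (f j x - f j y) := by fun_prop
      have := (hcont.tendsto 0).mono_left (nhdsWithin_le_nhds (s := Set.Ioi 0))
      rw [zero_mul, add_zero] at this
      exact (this.eventually_lt_const h).mono fun _ => le_of_lt
  obtain ⟨δ, hδ, hδ0 : 0 < δ⟩ := (hev.and self_mem_nhdsWithin).exists
  refine ((mem_extremePoints.1 hx).2 _ hδ _ hy.1 ⟨1 / (1 + δ), δ / (1 + δ), by positivity,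
    by positivity, by field_simp, ?_⟩).2.symm
  match_scalars <;> field_simp
  ring

theorem exists_pos_le_dist_of_finset {E : Type*} [MetricSpace E] (S : Finset E) :
    ∃ d > 0, ∀ s ∈ S, ∀ t ∈ S, s ≠ t → d ≤ dist s t := by
  have hev : ∀ᶠ d : ℝ in nhdsWithin 0 (Set.Ioi 0), ∀ s ∈ S, ∀ t ∈ S, s ≠ t → d ≤ dist s t := by
    refine (Filter.eventually_all_finset S).2 fun s _ => (Filter.eventually_all_finset S).2
      fun t _ => ?_
    by_cases h : s = t
    · simp [h]
    · have : ∀ᶠ d : ℝ in nhds 0, d < dist s t := eventually_lt_nhds (dist_pos.2 h)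
      exact (this.filter_mono nhdsWithin_le_nhds).mono fun _ hd _ => hd.le
  obtain ⟨d, hd, hd0⟩ := (hev.and self_mem_nhdsWithin).exists
  exact ⟨d, hd0, hd⟩

/-- A polytope in the closed unit ball approaches the unit sphere only at its vertices, and does so
at a linear rate. -/
theorem exists_mul_norm_sub_le_one_sub_sq {E : Type*} [NormedAddCommGroup E]
    [InnerProductSpace ℝ E] (S : Finset E) (hS : ∀ s ∈ S, ‖s‖ ≤ 1) :
    ∃ c > 0, ∀ y ∈ convexHull ℝ (S : Set E), ∃ v ∈ S, c * ‖y - v‖ ≤ 1 - ‖y‖ ^ 2 := by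
  obtain ⟨d, hd0, hd⟩ := exists_pos_le_dist_of_finset S
  -- With `v` the vertex nearest to `y`, every other vertex `s` has `‖s - y‖ ≥ d/2`, while `‖s - v‖
  -- ≤ 2`; thus `‖s - y‖² ≥ d²/4 ≥ (d²/8) ‖s - v‖`.
  refine ⟨d ^ 2 / 8, by positivity, fun y hy => ?_⟩
  have hne : S.Nonempty := by
    have : (convexHull ℝ (S : Set E)).Nonempty := ⟨y, hy⟩
    simpa using this
  obtain ⟨v, hv, hmin⟩ := S.exists_min_image (fun s => ‖s - y‖) hne
  refine ⟨v, hv, ?_⟩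
  obtain ⟨w, hw0, hw1, hwy⟩ := Finset.mem_convexHull'.1 hy
  -- The variance of the vertices about their mean `y` is `∑ w s ‖s‖² - ‖y‖²`, and each `‖s‖ ≤ 1`.
  have hvar : ∑ s ∈ S, w s * ‖s - y‖ ^ 2 ≤ 1 - ‖y‖ ^ 2 := by
    have hinner : ∑ s ∈ S, w s * inner ℝ s y = ‖y‖ ^ 2 := by
      rw [← real_inner_self_eq_norm_sq]
      nth_rewrite 2 [← hwy]
      rw [sum_inner]
      simp only [real_inner_smul_left]
    have hle : ∑ s ∈ S, w s * ‖s - y‖ ^ 2 ≤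
        ∑ s ∈ S, (w s - 2 * (w s * inner ℝ s y) + w s * ‖y‖ ^ 2) := by
      refine Finset.sum_le_sum fun s hs => ?_
      rw [norm_sub_sq_real]
      have h1 : ‖s‖ ^ 2 ≤ 1 := pow_le_one₀ (norm_nonneg _) (hS s hs)
      nlinarith [mul_le_mul_of_nonneg_left h1 (hw0 s hs)]
    rw [Finset.sum_add_distrib, Finset.sum_sub_distrib, ← Finset.mul_sum, ← Finset.sum_mul, hinner,
      hw1] at hle
    linarith
  have hfar : ∀ s ∈ S, s ≠ v → d / 2 ≤ ‖s - y‖ := by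
    intro s hs hsv
    have h1 := hd s hs v hv hsv
    have h2 := hmin s hs
    have h3 := norm_sub_le (s - y) (v - y)
    rw [sub_sub_sub_cancel_right, ← dist_eq_norm] at h3
    linarith
  have hterm : ∀ s ∈ S, d ^ 2 / 8 * (w s * ‖s - v‖) ≤ w s * ‖s - y‖ ^ 2 := by
    intro s hs
    by_cases hsv : s = v
    · subst hsv
      simpa using mul_nonneg (hw0 s hs) (sq_nonneg _)
    · have h1 : ‖s - v‖ ≤ 2 := (norm_sub_le _ _).trans (by linarith [hS s hs, hS v hv])
      have h2 : (d / 2) ^ 2 ≤ ‖s - y‖ ^ 2 := by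
        gcongr
        exact hfar s hs hsv
      have h3 : d ^ 2 / 8 * ‖s - v‖ ≤ ‖s - y‖ ^ 2 := by nlinarith [sq_nonneg d]
      nlinarith [mul_le_mul_of_nonneg_left h3 (hw0 s hs)]
  have hnorm : ‖y - v‖ ≤ ∑ s ∈ S, w s * ‖s - v‖ := by
    have : y - v = ∑ s ∈ S, w s • (s - v) := by
      simp only [smul_sub, Finset.sum_sub_distrib, hwy, ← Finset.sum_smul, hw1, one_smul]
    rw [this]
    refine (norm_sum_le _ _).trans (Finset.sum_le_sum fun s hs => ?_)
    rw [norm_smul, Real.norm_of_nonneg (hw0 s hs)]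
  calc d ^ 2 / 8 * ‖y - v‖ ≤ d ^ 2 / 8 * ∑ s ∈ S, w s * ‖s - v‖ := by gcongr
    _ ≤ ∑ s ∈ S, w s * ‖s - y‖ ^ 2 := by
        rw [Finset.mul_sum]
        exact Finset.sum_le_sum hterm
    _ ≤ 1 - ‖y‖ ^ 2 := hvar

theorem integrableOn_ball_norm_sub_rpow {E : Type*} [NormedAddCommGroup E] [NormedSpace ℝ E]
    [FiniteDimensional ℝ E] [MeasurableSpace E] [BorelSpace E] (μ : Measure E)
    [μ.IsAddHaarMeasure] {α : ℝ} (hd : 1 ≤ Module.finrank ℝ E) (hα : α < Module.finrank ℝ E)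
    (v : E) (r : ℝ) : IntegrableOn (fun y => ‖y - v‖ ^ (-α)) (Metric.ball 0 r) μ := by
  have h : IntegrableOn (fun y : E => ‖y‖ ^ (-α)) (Metric.ball 0 (r + ‖v‖)) μ := by
    refine integrableOn_ball_of_norm_le_rpow (C := 1) hd hα ?_ ?_
    · refine Filter.Eventually.of_forall fun y => ?_
      rw [one_mul, Real.norm_of_nonneg (by positivity)]
    · exact (measurable_norm.pow_const _).aestronglyMeasurable
  have h2 := ((measurePreserving_sub_right μ v).integrableOn_comp_preimage
    (MeasurableEquiv.subRight v).measurableEmbedding).2 h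
  refine h2.mono_set fun y hy => ?_
  rw [mem_ball_zero_iff] at hy
  rw [Set.mem_preimage, mem_ball_zero_iff]
  linarith [norm_sub_le y v]

theorem hyperbolicVolume_convexHull_lt_top {n : ℕ} (hn : 2 ≤ n)
    (S : Finset (EuclideanSpace ℝ (Fin n))) (hS : ∀ s ∈ S, ‖s‖ ≤ 1) :
    hyperbolicVolume n (convexHull ℝ (S : Set (EuclideanSpace ℝ (Fin n)))) < ⊤ := by
  obtain ⟨c, hc, hcS⟩ := exists_mul_norm_sub_le_one_sub_sq S hS
  set K := convexHull ℝ (S : Set (EuclideanSpace ℝ (Fin n))) with hK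
  have hKm : MeasurableSet K := (S.finite_toSet.isClosed_convexHull ℝ).measurableSet
  set α : ℝ := ((n : ℝ) + 1) / 2 with hα
  have hαn : α < n := by
    have : (2 : ℝ) ≤ n := by exact_mod_cast hn
    rw [hα]; linarith
  have hint : ∀ v ∈ S, ∫⁻ y in Metric.ball (0 : EuclideanSpace ℝ (Fin n)) 1,
      ENNReal.ofReal (c ^ (-α) * ‖y - v‖ ^ (-α)) < ⊤ := by
    intro v _
    refine Integrable.lintegral_lt_top (Integrable.const_mul ?_ _)
    exact integrableOn_ball_norm_sub_rpow volume (by simp; omega) (by simpa using hαn) v 1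
  rw [hyperbolicVolume, withDensity_apply _ hKm]
  refine lt_of_le_of_lt ?_ (ENNReal.sum_lt_top.2 hint)
  rw [← lintegral_finsetSum]
  swap
  · intro v _
    exact ENNReal.measurable_ofReal.comp
      (((measurable_id.sub_const v).norm.pow_const _).const_mul _)
  rw [← lintegral_indicator hKm]
  -- Vertices must be discarded: since `0 ^ (-α) = 0` for real powers, the majorant's singular term
  -- vanishes there.
  have hnull : ∀ᵐ y ∂((volume : Measure (EuclideanSpace ℝ (Fin n))).restrict (Metric.ball 0 1)),
      y ∉ S := by
    refine ae_restrict_of_ae ?_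
    have : Nonempty (Fin n) := ⟨⟨0, by omega⟩⟩
    exact S.finite_toSet.countable.ae_notMem volume
  refine lintegral_mono_ae ?_
  filter_upwards [hnull] with y hy
  by_cases hyK : y ∈ K
  · rw [Set.indicator_of_mem hyK]
    obtain ⟨v, hv, hle⟩ := hcS y hyK
    have hpos : 0 < ‖y - v‖ := norm_pos_iff.2 (sub_ne_zero.2 fun h => hy (h ▸ hv))
    refine le_trans (ENNReal.ofReal_le_ofReal ?_) (Finset.single_le_sum
      (f := fun v => ENNReal.ofReal (c ^ (-α) * ‖y - v‖ ^ (-α))) (fun _ _ => zero_le) hv)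
    rw [← Real.mul_rpow hc.le hpos.le, neg_div]
    exact Real.rpow_le_rpow_of_nonpos (by positivity) hle (neg_nonpos.2 (by positivity))
  · rw [Set.indicator_of_notMem hyK]
    exact zero_le

theorem hyperbolicVolume_halfSpaces_lt_top {n : ℕ} (hn : 2 ≤ n) {J : Type*} [Finite J]
    (f : J → EuclideanSpace ℝ (Fin n) →L[ℝ] ℝ) (c : J → ℝ)
    (hball : ∀ y, (∀ j, f j y ≤ c j) → ‖y‖ ≤ 1) :
    hyperbolicVolume n {y | ∀ j, f j y ≤ c j} < ⊤ := by
  set Q := {y | ∀ j, f j y ≤ c j} with hQ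
  have hQeq : Q = ⋂ j, {y | f j y ≤ c j} := by ext; simp [hQ]
  have hfin : (Q.extremePoints ℝ).Finite :=
    finite_extremePoints_of_halfSpaces (fun j => (f j).toLinearMap) c
  have hconv : Convex ℝ Q := by
    rw [hQeq]
    exact convex_iInter fun j => convex_halfSpace_le (f j).toLinearMap.isLinear _
  have hclosed : IsClosed Q := by
    rw [hQeq]
    exact isClosed_iInter fun j => isClosed_le (f j).continuous continuous_const
  have hcomp : IsCompact Q := (isCompact_closedBall 0 1).of_isClosed_subset hclosed fun y hy =>
    mem_closedBall_zero_iff.2 (hball y hy)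
  -- Krein-Milman; with finitely many extreme points the hull is already closed.
  rw [← closure_convexHull_extremePoints hcomp hconv, (hfin.isClosed_convexHull ℝ).closure_eq,
    ← hfin.coe_toFinset]
  exact hyperbolicVolume_convexHull_lt_top hn _ fun s hs =>
    hball s (extremePoints_subset (hfin.mem_toFinset.1 hs))

/-- The functionals cutting out the weight polytope in the projective model. -/
noncomputable def incidenceFunctional (σ : PlanePoint ≃ Fin 13) :
    ZMod 13 ⊕ ZMod 13 → EuclideanSpace ℝ (Fin 13) →L[ℝ] ℝ :=
  Sum.elim (fun i => EuclideanSpace.proj (singerIndex σ i))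
    fun l => -∑ i ∈ singerLine l, EuclideanSpace.proj (singerIndex σ i)

theorem hyperbolicVolume_incidenceCone_lt_top (σ : PlanePoint ≃ Fin 13) :
    hyperbolicVolume 13 (inducedHyperbolicSet (incidenceCone σ)) < ⊤ := by
  refine lt_of_le_of_lt (measure_mono ?_) (hyperbolicVolume_halfSpaces_lt_top (by norm_num)
    (incidenceFunctional σ) (Sum.elim (fun _ => 0) fun _ => 1) fun y hy => ?_)
  · rintro _ ⟨x, ⟨hx, -, hx0⟩, rfl⟩
    rw [mem_incidenceCone_iff] at hx
    rintro (i | l)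
    · simpa [incidenceFunctional, toHyperbolicBall] using
        div_nonpos_of_nonpos_of_nonneg (hx.1 i) hx0.le
    · have := (div_le_one hx0).2 (hx.2 l)
      simpa [incidenceFunctional, toHyperbolicBall, ← Finset.sum_div, neg_div] using this
  · have h := sum_sq_le_one (z := fun i => -y (singerIndex σ i)) ⟨fun i => ?_, fun l => ?_⟩
    · rw [← sq_le_one_iff₀ (norm_nonneg y), EuclideanSpace.norm_sq_eq]
      simp only [Real.norm_eq_abs, sq_abs]
      rw [← Equiv.sum_comp (singerIndex σ)]
      simpa using h
    · simpa [incidenceFunctional] using hy (Sum.inl i)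
    · simpa [incidenceFunctional] using hy (Sum.inr l)

theorem theorem1p3 (σ : PlanePoint ≃ Fin 13) :
    (∀ p q : PlanePoint,
      (p = q → lorentzInner (pointRoot σ p) (pointRoot σ q) = 1) ∧
      (p ≠ q → lorentzInner (pointRoot σ p) (pointRoot σ q) = 0)) ∧
    (∀ l m : PlaneLine,
      (l = m → lorentzInner (lineRoot σ l) (lineRoot σ m) = 3) ∧
      (l ≠ m → lorentzInner (lineRoot σ l) (lineRoot σ m) = 0)) ∧
    (∀ (p : PlanePoint) (l : PlaneLine),
      (p ∈ l → lorentzInner (pointRoot σ p) (lineRoot σ l) = -1) ∧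
      (p ∉ l → lorentzInner (pointRoot σ p) (lineRoot σ l) = 0)) ∧
    hyperbolicVolume 13 (inducedHyperbolicSet (incidenceCone σ)) < ⊤ ∧
    incidenceCone σ ⊆ normOneChamber 13 :=
  ⟨lorentzInner_pointRoot_pointRoot σ, lorentzInner_lineRoot_lineRoot σ,
    lorentzInner_pointRoot_lineRoot σ, hyperbolicVolume_incidenceCone_lt_top σ,
    incidenceCone_subset_normOneChamber σ⟩
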